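/- Fix real numbers $0<q<1$ and $a>0$. Write $(x;q)_n=\prod_{i=0}^{n-1}(1-xq^i)$ and $(x;q)_\infty=\prod_{i=0}^{\infty}(1-xq^i)$. For $n,m\in\{0,1,2,\dots\}$ put $\mu(m)=q^{-m}-aq^m$ and $$d_n(\mu(m);a;q)={}_3\phi_0\!\left(q^{-m},-aq^m,q^{-n};\,-\,;\,q,-\tfrac{q^n}{a}\right)=\sum_{k=0}^{\infty}\frac{(q^{-m};q)_k\,(-aq^m;q)_k\,(q^{-n};q)_k}{(q;q)_k}\left((-1)^kq^{k(k-1)/2}\right)^{-2}\left(-\frac{q^n}{a}\right)^k,$$ a sum in which only finitely many terms are nonzero. **Theorem.** (i) For every $n\ge 0$, $d_n(\mu(m);a;q)$ is a polynomial of degree exactly $n$ in $\mu(m)$: there is a real polynomial $P_n$ of degree $n$ such that $d_n(\mu(m);a;q)=P_n(\mu(m))$ for all $m=0,1,2,\dots$. (ii) These polynomials (the dual alternative $q$-Charlier polynomials) are orthogonal on the set of points $\mu(m)$, $m=0,1,2,\dots$: for all $n,n'\ge 0$ the following series converges absolutely and $$\sum_{m=0}^{\infty}\frac{(1+aq^{2m})\,a^m\,q^{m(3m-1)/2}}{(-aq^m;q)_\infty\,(q;q)_m}\,d_n(\mu(m);a;q)\,d_{n'}(\mu(m);a;q)=\frac{(q;q)_n}{a^n\,q^{n(n+1)/2}}\,\delta_{nn'}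 .$$ -/

import Mathlib

open scoped BigOperators Polynomial

noncomputable section

/-- The finite `q`-shifted factorial `(x; q)_n = ∏_{i < n} (1 - x q^i)`. -/
def qPochhammer (x q : ℝ) (n : ℕ) : ℝ := ∏ i ∈ Finset.range n, (1 - x * q ^ i)

/-- The infinite `q`-shifted factorial `(x; q)_∞ = ∏_{i ≥ 0} (1 - x q^i)`
(an absolutely convergent product when `|q| < 1`). -/
def qPochhammerInf (x q : ℝ) : ℝ := ∏' i : ℕ, (1 - x * q ^ i)

/-- The `k`-th term of the basic hypergeometric series `ᵣφₛ(as; bs; q, z)`, where `as` and `bs`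
are the lists of the `r` upper and the `s` lower parameters:
`(a₁;q)_k ⋯ (aᵣ;q)_k / ((b₁;q)_k ⋯ (bₛ;q)_k (q;q)_k) * ((-1)^k q^(k(k-1)/2))^(1+s-r) * z^k`.
The exponent `1 + s - r` is an integer, possibly negative, and `k.choose 2 = k(k-1)/2`. -/
def basicHypergeometricTerm (as bs : List ℝ) (q z : ℝ) (k : ℕ) : ℝ :=
  (as.map fun x => qPochhammer x q k).prod /
      ((bs.map fun x => qPochhammer x q k).prod * qPochhammer q q k) *
    ((-1) ^ k * q ^ k.choose 2) ^ (1 + (bs.length : ℤ) - (as.length : ℤ)) * z ^ k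

/-- The basic hypergeometric series `ᵣφₛ(as; bs; q, z)`. It is only used below with an upper
parameter `q^(-n)`, when it has finitely many nonzero terms. -/
def basicHypergeometric (as bs : List ℝ) (q z : ℝ) : ℝ :=
  ∑' k : ℕ, basicHypergeometricTerm as bs q z k

/-- The `q`-quadratic lattice `μ(m) = q^(-m) - a q^m`. -/
def latticePoint (a q : ℝ) (m : ℕ) : ℝ := q ^ (-(m : ℤ)) - a * q ^ m

/-- The value `d_n(μ(m); a; q) = ₃φ₀(q^(-m), -a q^m, q^(-n); –; q, -q^n / a)` of the dual
alternative `q`-Charlier polynomial at the lattice point `μ(m)`. -/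
def dualAltCharlier (a q : ℝ) (n m : ℕ) : ℝ :=
  basicHypergeometric [q ^ (-(m : ℤ)), -a * q ^ m, q ^ (-(n : ℤ))] [] q (-q ^ n / a)

/-- The weight `(1 + a q^(2m)) a^m q^(m(3m-1)/2) / ((-a q^m; q)_∞ (q; q)_m)`.
The exponent `m(3m-1)/2` is a natural number for every `m`. -/
def dualAltCharlierWeight (a q : ℝ) (m : ℕ) : ℝ :=
  (1 + a * q ^ (2 * m)) * a ^ m * q ^ (m * (3 * m - 1) / 2) /
    (qPochhammerInf (-a * q ^ m) q * qPochhammer q q m)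

end

open Filter Topology


/-! Write `E_a` for summation against the weight with parameter `a`. Telescoping gives `E_a[1] =
E_{aq}[1]`, and letting `a q^N → 0` leaves only the mass at `m = 0`, so `E_a[1] = 1`. The factor `1
- μ - a` kills the point `m = 0` and turns the remaining weight into `-a` times the weight for `a
q^2`, with lattice scaled by `q⁻¹`: `E_a[(1 - μ - a) f(μ)] = -a E_{aq²}[f(μ/q)]`
(`hasSum_weight_shift`).

With `f = μ^i` this shows that `E_a[μ^i] = p_i(a)` for a polynomial `p_i` of degree at most `i/2`
with `p_i(0) = 1`. Iterated, it gives `E_a[(q^{-m};q)_k (-aq^m;q)_k μ^i]` as an explicit factor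
times `p_i(a q^{2k})`. Summing over `k` with the coefficients of `d_n`, the finite `q`-binomial
theorem yields `E_a[d_n μ^i] = ∑_l p_{i,l} a^l (q^{2l-i};q)_n`. For `i ≤ n` only `i = n`, `l = 0`
survives, since `(q^{-t};q)_n = 0` for `0 ≤ t < n`. The norm is this value times the leading
coefficient `(-1/a)^n`. -/

/-! ### Finite and infinite `q`-shifted factorials. -/

theorem qPochhammer_succ (x q : ℝ) (n : ℕ) :
    qPochhammer x q (n + 1) = qPochhammer x q n * (1 - x * q ^ n) := by
  simp [qPochhammer, Finset.prod_range_succ]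

theorem qPochhammer_self_succ (q : ℝ) (n : ℕ) :
    qPochhammer q q (n + 1) = qPochhammer q q n * (1 - q ^ (n + 1)) := by
  rw [qPochhammer_succ, pow_succ']

theorem qPochhammer_self_lower {q : ℝ} (hq0 : 0 < q) (hq1 : q < 1) (n : ℕ) :
    (1 - q) ^ n ≤ qPochhammer q q n := by
  induction n with
  | zero => simp [qPochhammer]
  | succ n ih =>
    rw [qPochhammer_self_succ, pow_succ]
    have h : q ^ (n + 1) ≤ q := pow_le_of_le_one hq0.le hq1.le (Nat.succ_ne_zero n)
    have h1 : 0 ≤ 1 - q := by linarith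
    exact mul_le_mul ih (by linarith) h1 ((pow_nonneg h1 n).trans ih)

theorem qPochhammer_self_pos {q : ℝ} (hq0 : 0 < q) (hq1 : q < 1) (n : ℕ) :
    0 < qPochhammer q q n :=
  (pow_pos (by linarith) n).trans_le (qPochhammer_self_lower hq0 hq1 n)

theorem multipliable_qPochhammer (x : ℝ) {q : ℝ} (hq0 : 0 < q) (hq1 : q < 1) :
    Multipliable fun i : ℕ => 1 - x * q ^ i := by
  have := Real.multipliable_one_add_of_summable
    ((summable_geometric_of_lt_one hq0.le hq1).mul_left (-x))
  simpa [sub_eq_add_neg] using this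

theorem qPochhammerInf_split (x : ℝ) {q : ℝ} (hq0 : 0 < q) (hq1 : q < 1) (k : ℕ) :
    qPochhammerInf x q = qPochhammer x q k * qPochhammerInf (x * q ^ k) q := by
  have e : (fun i : ℕ => 1 - x * q ^ k * q ^ i) = fun i : ℕ => 1 - x * q ^ (i + k) := by
    funext i
    ring
  have h := multipliable_qPochhammer (x * q ^ k) hq0 hq1
  rw [e] at h
  have h2 := Multipliable.prod_mul_tprod_nat_mul' (f := fun i : ℕ => 1 - x * q ^ i) h
  unfold qPochhammerInf qPochhammer
  rw [e]
  exact h2.symm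

theorem qPochhammerInf_neg_succ (a : ℝ) {q : ℝ} (hq0 : 0 < q) (hq1 : q < 1) (m : ℕ) :
    qPochhammerInf (-a * q ^ m) q =
      (1 + a * q ^ m) * qPochhammerInf (-a * q ^ (m + 1)) q := by
  rw [qPochhammerInf_split _ hq0 hq1 1]
  simp [qPochhammer, pow_succ, mul_assoc]

theorem one_le_qPochhammerInf_neg {x q : ℝ} (hx : 0 ≤ x) (hq0 : 0 < q) (hq1 : q < 1) :
    1 ≤ qPochhammerInf (-x) q := by
  refine ge_of_tendsto (multipliable_qPochhammer (-x) hq0 hq1).hasProd.tendsto_prod_nat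
    (Eventually.of_forall fun n => ?_)
  have h : ∀ i ∈ Finset.range n, 1 ≤ 1 - -x * q ^ i := fun i _ => by
    have : 0 ≤ x * q ^ i := by positivity
    linarith
  simpa using Finset.prod_le_prod (fun _ _ => zero_le_one) h

theorem one_le_qPochhammerInf_neg_mul {a q : ℝ} (ha : 0 ≤ a) (hq0 : 0 < q) (hq1 : q < 1) (m : ℕ) :
    1 ≤ qPochhammerInf (-a * q ^ m) q := by
  rw [neg_mul]
  exact one_le_qPochhammerInf_neg (by positivity) hq0 hq1

theorem tendsto_qPochhammerInf_neg_pow {a q : ℝ} (ha : 0 < a) (hq0 : 0 < q) (hq1 : q < 1) :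
    Tendsto (fun N : ℕ => qPochhammerInf (-a * q ^ N) q) atTop (𝓝 1) := by
  have h := (multipliable_qPochhammer (-a) hq0 hq1).hasProd.tendsto_prod_nat
  have hne : (∏' i : ℕ, (1 - -a * q ^ i)) ≠ 0 :=
    (zero_lt_one.trans_le (one_le_qPochhammerInf_neg ha.le hq0 hq1)).ne'
  have h2 := (tendsto_const_nhds (x := ∏' i : ℕ, (1 - -a * q ^ i))).div h hne
  rw [div_self hne] at h2
  refine h2.congr fun N => ?_
  have hs := qPochhammerInf_split (-a) hq0 hq1 N
  have hN : qPochhammer (-a) q N ≠ 0 := by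
    intro h0
    rw [h0, zero_mul] at hs
    exact hne hs
  rw [show (∏' i : ℕ, (1 - -a * q ^ i)) = qPochhammerInf (-a) q from rfl, hs]
  exact mul_div_cancel_left₀ _ hN

/-! ### Growth and summability of the weight. -/

theorem pentagonal_succ (m : ℕ) :
    (m + 1) * (3 * (m + 1) - 1) / 2 = m * (3 * m - 1) / 2 + (3 * m + 1) := by
  have h : (m + 1) * (3 * (m + 1) - 1) = m * (3 * m - 1) + 2 * (3 * m + 1) := by
    -- At `m = 0` the subtraction `3 * m - 1` truncates, harmlessly because of the factor `m`.
    cases m with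
    | zero => rfl
    | succ k =>
      rw [show 3 * (k + 1 + 1) - 1 = 3 * k + 5 by omega, show 3 * (k + 1) - 1 = 3 * k + 2 by omega]
      ring
  rw [h, Nat.add_mul_div_left _ _ two_pos]

theorem summable_pow_mul_pentagonal {C q : ℝ} (hC : 0 < C) (hq0 : 0 < q) (hq1 : q < 1) :
    Summable fun m : ℕ => C ^ m * q ^ (m * (3 * m - 1) / 2) := by
  refine summable_of_ratio_test_tendsto_lt_one zero_lt_one
    (Eventually.of_forall fun n => by positivity) ?_
  have h : Tendsto (fun n : ℕ => C * q * (q ^ 3) ^ n) atTop (𝓝 0) := by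
    simpa using (tendsto_pow_atTop_nhds_zero_of_lt_one (by positivity)
      (pow_lt_one₀ hq0.le hq1 three_ne_zero)).const_mul (C * q)
  refine h.congr fun n => ?_
  rw [Real.norm_of_nonneg (by positivity), Real.norm_of_nonneg (by positivity), pentagonal_succ,
    eq_div_iff (by positivity)]
  ring

theorem dualAltCharlierWeight_nonneg {a q : ℝ} (ha : 0 < a) (hq0 : 0 < q) (hq1 : q < 1) (m : ℕ) :
    0 ≤ dualAltCharlierWeight a q m := by
  have h1 := one_le_qPochhammerInf_neg_mul ha.le hq0 hq1 m
  have h2 := qPochhammer_self_pos hq0 hq1 m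
  unfold dualAltCharlierWeight
  positivity

theorem div_qPochhammer_le {a q : ℝ} (ha : 0 < a) (hq0 : 0 < q) (hq1 : q < 1) (m : ℕ) {x : ℝ}
    (hx : 0 ≤ x) :
    x / (qPochhammerInf (-a * q ^ m) q * qPochhammer q q m) ≤ x / (1 - q) ^ m := by
  have h1 := one_le_qPochhammerInf_neg_mul ha.le hq0 hq1 m
  have h2 := qPochhammer_self_lower hq0 hq1 m
  have h3 : 0 < (1 - q) ^ m := pow_pos (by linarith) m
  refine div_le_div_of_nonneg_left hx h3 ?_
  nlinarith

theorem dualAltCharlierWeight_le {a q : ℝ} (ha : 0 < a) (hq0 : 0 < q) (hq1 : q < 1) (m : ℕ) :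
    dualAltCharlierWeight a q m ≤
      (1 + a) * ((a / (1 - q)) ^ m * q ^ (m * (3 * m - 1) / 2)) := by
  refine (div_qPochhammer_le ha hq0 hq1 m (by positivity)).trans ?_
  have h3 : 0 < (1 - q) ^ m := pow_pos (by linarith) m
  rw [div_pow, div_mul_eq_mul_div, mul_div_assoc', ← mul_assoc]
  have : q ^ (2 * m) ≤ 1 := pow_le_one₀ hq0.le hq1.le
  gcongr
  nlinarith

theorem summable_weight_bound {a q : ℝ} (ha : 0 < a) (hq0 : 0 < q) (hq1 : q < 1) :
    Summable fun m : ℕ => (1 + a) * ((a / (1 - q)) ^ m * q ^ (m * (3 * m - 1) / 2)) :=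
  (summable_pow_mul_pentagonal (div_pos ha (by linarith)) hq0 hq1).mul_left _

theorem summable_dualAltCharlierWeight {a q : ℝ} (ha : 0 < a) (hq0 : 0 < q) (hq1 : q < 1) :
    Summable (dualAltCharlierWeight a q) :=
  .of_nonneg_of_le (dualAltCharlierWeight_nonneg ha hq0 hq1)
    (dualAltCharlierWeight_le ha hq0 hq1) (summable_weight_bound ha hq0 hq1)

/-! ### Total mass of the weight. -/

/-- The antidifference of the weight with respect to the scaling `a ↦ a q`. -/
noncomputable def weightAntidifference (a q : ℝ) (m : ℕ) : ℝ :=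
  a ^ m * q ^ (m * (3 * m - 1) / 2) * (1 - q ^ m) /
    (qPochhammerInf (-a * q ^ m) q * qPochhammer q q m)

theorem weight_sub_weight_mul {a q : ℝ} (ha : 0 < a) (hq0 : 0 < q) (hq1 : q < 1) (m : ℕ) :
    dualAltCharlierWeight a q m - dualAltCharlierWeight (a * q) q m =
      weightAntidifference a q m - weightAntidifference a q (m + 1) := by
  unfold dualAltCharlierWeight weightAntidifference
  have e : -(a * q) * q ^ m = -a * q ^ (m + 1) := by ring
  rw [e, qPochhammerInf_neg_succ a hq0 hq1 m, qPochhammer_self_succ, pentagonal_succ]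
  have h1 := one_le_qPochhammerInf_neg_mul ha.le hq0 hq1 (m + 1)
  have h2 := qPochhammer_self_pos hq0 hq1 m
  have h3 : q ^ (m + 1) < 1 := pow_lt_one₀ hq0.le hq1 (Nat.succ_ne_zero m)
  have h4 : 0 < 1 + a * q ^ m := by positivity
  generalize qPochhammerInf (-a * q ^ (m + 1)) q = E at *
  generalize qPochhammer q q m = D at *
  have h5 : 1 - q ^ (m + 1) ≠ 0 := by linarith
  have hE : E ≠ 0 := by linarith
  have e3 : a ^ (m + 1) * q ^ (m * (3 * m - 1) / 2 + (3 * m + 1)) * (1 - q ^ (m + 1)) /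
      (E * (D * (1 - q ^ (m + 1)))) =
      a ^ (m + 1) * q ^ (m * (3 * m - 1) / 2 + (3 * m + 1)) * (1 + a * q ^ m) /
        ((1 + a * q ^ m) * E * D) := by
    field_simp
  have e4 : (1 + a * q * q ^ (2 * m)) * (a * q) ^ m * q ^ (m * (3 * m - 1) / 2) / (E * D) =
      (1 + a * q * q ^ (2 * m)) * (a * q) ^ m * q ^ (m * (3 * m - 1) / 2) * (1 + a * q ^ m) /
        ((1 + a * q ^ m) * E * D) := by
    field_simp
  rw [e3, e4, ← sub_div, ← sub_div]
  congr 1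
  ring

theorem tendsto_weightAntidifference {a q : ℝ} (ha : 0 < a) (hq0 : 0 < q) (hq1 : q < 1) :
    Tendsto (weightAntidifference a q) atTop (𝓝 0) := by
  have hq : ∀ m : ℕ, 0 ≤ 1 - q ^ m := fun m => sub_nonneg.2 (pow_le_one₀ hq0.le hq1.le)
  refine squeeze_zero (fun m => ?_) (fun m => ?_)
    (summable_pow_mul_pentagonal (div_pos ha (sub_pos.2 hq1)) hq0 hq1).tendsto_atTop_zero
  · have h1 := one_le_qPochhammerInf_neg_mul ha.le hq0 hq1 m
    have h2 := qPochhammer_self_pos hq0 hq1 m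
    have := hq m
    unfold weightAntidifference
    positivity
  · have := hq m
    refine (div_qPochhammer_le ha hq0 hq1 m (by positivity)).trans ?_
    have h3 : 0 < (1 - q) ^ m := pow_pos (by linarith) m
    rw [div_pow, div_mul_eq_mul_div]
    refine div_le_div_of_nonneg_right (mul_le_of_le_one_right (by positivity) ?_) h3.le
    have : 0 < q ^ m := by positivity
    linarith

/-- The difference telescopes with no boundary term: the factor `1 - q ^ m` makes the antidifference
vanish at `m = 0`, and it tends to `0` at infinity. -/
theorem tsum_weight_mul {a q : ℝ} (ha : 0 < a) (hq0 : 0 < q) (hq1 : q < 1) :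
    ∑' m, dualAltCharlierWeight (a * q) q m = ∑' m, dualAltCharlierWeight a q m := by
  have hs := (summable_dualAltCharlierWeight ha hq0 hq1).hasSum.sub
    (summable_dualAltCharlierWeight (mul_pos ha hq0) hq0 hq1).hasSum
  have h1 := hs.tendsto_sum_nat
  simp only [weight_sub_weight_mul ha hq0 hq1, Finset.sum_range_sub'] at h1
  have h2 := (tendsto_const_nhds (x := weightAntidifference a q 0)).sub
    (tendsto_weightAntidifference ha hq0 hq1)
  have h3 := tendsto_nhds_unique h1 h2
  simp [weightAntidifference] at h3
  linarith

theorem tsum_weight_mul_pow {a q : ℝ} (ha : 0 < a) (hq0 : 0 < q) (hq1 : q < 1) (N : ℕ) :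
    ∑' m, dualAltCharlierWeight (a * q ^ N) q m = ∑' m, dualAltCharlierWeight a q m := by
  induction N with
  | zero => simp
  | succ N ih => rw [pow_succ, ← mul_assoc, tsum_weight_mul (by positivity) hq0 hq1, ih]

theorem weight_scaled_le {a q : ℝ} (ha : 0 < a) (hq0 : 0 < q) (hq1 : q < 1) (N m : ℕ) :
    dualAltCharlierWeight (a * q ^ N) q m ≤
      (q ^ N) ^ m * ((1 + a) * ((a / (1 - q)) ^ m * q ^ (m * (3 * m - 1) / 2))) := by
  refine (dualAltCharlierWeight_le (by positivity) hq0 hq1 m).trans ?_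
  have h : a * q ^ N ≤ a := mul_le_of_le_one_right ha.le (pow_le_one₀ hq0.le hq1.le)
  have h3 : 0 < 1 - q := by linarith
  rw [mul_div_right_comm, mul_pow]
  calc (1 + a * q ^ N) * ((a / (1 - q)) ^ m * (q ^ N) ^ m * q ^ (m * (3 * m - 1) / 2))
      ≤ (1 + a) * ((a / (1 - q)) ^ m * (q ^ N) ^ m * q ^ (m * (3 * m - 1) / 2)) := by gcongr
    _ = _ := by ring

theorem hasSum_dualAltCharlierWeight {a q : ℝ} (ha : 0 < a) (hq0 : 0 < q) (hq1 : q < 1) :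
    HasSum (dualAltCharlierWeight a q) 1 := by
  -- The total mass does not depend on `N`, while termwise the weight for `a q^N` concentrates at `m
  -- = 0`.
  have key : Tendsto (fun N : ℕ => ∑' m, dualAltCharlierWeight (a * q ^ N) q m) atTop
      (𝓝 (∑' m : ℕ, if m = 0 then (1 : ℝ) else 0)) := by
    refine tendsto_tsum_of_dominated_convergence (summable_weight_bound ha hq0 hq1)
      (fun m => ?_) (Eventually.of_forall fun N m => ?_)
    · split_ifs with hm
      · subst hm
        have hp := tendsto_pow_atTop_nhds_zero_of_lt_one hq0.le hq1
        have h := ((hp.const_mul a).const_add 1).div (tendsto_qPochhammerInf_neg_pow ha hq0 hq1)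
          one_ne_zero
        rw [mul_zero, add_zero, div_one] at h
        refine h.congr fun N => ?_
        simp [dualAltCharlierWeight, qPochhammer]
      · refine squeeze_zero (fun N => dualAltCharlierWeight_nonneg (by positivity) hq0 hq1 m)
          (fun N => weight_scaled_le ha hq0 hq1 N m) ?_
        have hp : Tendsto (fun N : ℕ => (q ^ N) ^ m) atTop (𝓝 0) := by
          simpa only [← pow_mul, mul_comm m, pow_mul _ m] using
            tendsto_pow_atTop_nhds_zero_of_lt_one (pow_nonneg hq0.le m)
              (pow_lt_one₀ hq0.le hq1 hm)
        simpa using hp.mul_const ((1 + a) * ((a / (1 - q)) ^ m * q ^ (m * (3 * m - 1) / 2)))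
    · rw [Real.norm_of_nonneg (dualAltCharlierWeight_nonneg (by positivity) hq0 hq1 m)]
      refine (weight_scaled_le ha hq0 hq1 N m).trans (mul_le_of_le_one_left ?_ ?_)
      · have : 0 < 1 - q := by linarith
        positivity
      · exact pow_le_one₀ (by positivity) (pow_le_one₀ hq0.le hq1.le)
  simp only [tsum_weight_mul_pow ha hq0 hq1, tsum_ite_eq] at key
  rw [← tendsto_nhds_unique tendsto_const_nhds key]
  exact (summable_dualAltCharlierWeight ha hq0 hq1).hasSum

/-! ### The shift `a ↦ a q^2` and the moments. -/

theorem weight_succ_mul {a q : ℝ} (ha : 0 < a) (hq0 : 0 < q) (hq1 : q < 1) (m : ℕ) :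
    dualAltCharlierWeight a q (m + 1) * (1 - latticePoint a q (m + 1) - a) =
      -a * dualAltCharlierWeight (a * q ^ 2) q m := by
  unfold dualAltCharlierWeight latticePoint
  have e : -(a * q ^ 2) * q ^ m = -a * q ^ (m + 1 + 1) := by ring
  rw [e, qPochhammerInf_neg_succ a hq0 hq1 (m + 1), qPochhammer_self_succ, pentagonal_succ,
    zpow_neg, zpow_natCast]
  have h1 := one_le_qPochhammerInf_neg_mul ha.le hq0 hq1 (m + 1 + 1)
  have h2 := qPochhammer_self_pos hq0 hq1 m
  have h3 : q ^ (m + 1) < 1 := pow_lt_one₀ hq0.le hq1 (Nat.succ_ne_zero m)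
  have h4 : 0 < 1 + a * q ^ (m + 1) := by positivity
  generalize qPochhammerInf (-a * q ^ (m + 1 + 1)) q = E at *
  generalize qPochhammer q q m = D at *
  have h5 : 1 - q ^ (m + 1) ≠ 0 := by linarith
  have hE : E ≠ 0 := by linarith
  have h6 : 1 - ((q ^ (m + 1))⁻¹ - a * q ^ (m + 1)) - a =
      -((1 - q ^ (m + 1)) * (1 + a * q ^ (m + 1)) / q ^ (m + 1)) := by
    field_simp
    ring
  rw [h6, pow_add q _ (3 * m + 1), show 3 * m + 1 = 2 * m + (m + 1) by ring, pow_add q (2 * m),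
    show 2 * (m + 1) = 2 * m + 2 by ring, mul_pow a (q ^ 2), ← pow_mul q 2, pow_add q (2 * m) 2,
    pow_succ a m]
  generalize q ^ (m * (3 * m - 1) / 2) = Q
  have hP : q ^ (m + 1) ≠ 0 := by positivity
  generalize q ^ (m + 1) = P at *
  field_simp

theorem latticePoint_shift (a q : ℝ) (m : ℕ) :
    q⁻¹ * latticePoint (a * q ^ 2) q m = latticePoint a q (m + 1) := by
  unfold latticePoint
  rw [zpow_neg, zpow_neg, zpow_natCast, zpow_natCast, mul_sub, ← mul_inv, ← pow_succ']
  congr 1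
  field_simp
  ring

theorem hasSum_weight_shift {a q : ℝ} (ha : 0 < a) (hq0 : 0 < q) (hq1 : q < 1) {f : ℝ → ℝ}
    {c : ℝ}
    (h : HasSum (fun m => dualAltCharlierWeight (a * q ^ 2) q m *
      f (q⁻¹ * latticePoint (a * q ^ 2) q m)) c) :
    HasSum (fun m => dualAltCharlierWeight a q m *
      ((1 - latticePoint a q m - a) * f (latticePoint a q m))) (-a * c) := by
  rw [← hasSum_nat_add_iff' 1]
  have h0 : 1 - latticePoint a q 0 - a = 0 := by simp [latticePoint]
  simp only [Finset.sum_range_one, h0, zero_mul, mul_zero, sub_zero]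
  refine (h.mul_left (-a)).congr_fun fun m => ?_
  rw [← mul_assoc, weight_succ_mul ha hq0 hq1, latticePoint_shift]
  ring

/-- The bound `i/2` on the degree in `a`, rather than `i`, is what later keeps every exponent `2l -
i` nonpositive. -/
theorem exists_moment_polynomial {q : ℝ} (hq0 : 0 < q) (hq1 : q < 1) (i : ℕ) :
    ∃ p : ℝ[X], (∀ l, i < 2 * l → p.coeff l = 0) ∧ p.coeff 0 = 1 ∧
      ∀ a, 0 < a → HasSum (fun m => dualAltCharlierWeight a q m * latticePoint a q m ^ i)
        (p.eval a) := by
  induction i with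
  | zero =>
    refine ⟨1, fun l hl => ?_, by simp, fun a ha => ?_⟩
    · rw [Polynomial.coeff_one, if_neg (by omega)]
    · simpa using hasSum_dualAltCharlierWeight ha hq0 hq1
  | succ i ih =>
    obtain ⟨p, hdeg, hp0, hp⟩ := ih
    -- From `μ = (1 - a) - (1 - μ - a)`: `p_{i+1}(a) = (1 - a) p_i(a) + a q^{-i} p_i(a q^2)`.
    refine ⟨p - Polynomial.X * (p - Polynomial.C ((q⁻¹) ^ i) *
      p.comp (Polynomial.C (q ^ 2) * Polynomial.X)), fun l hl => ?_, ?_, fun a ha => ?_⟩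
    · obtain ⟨l, rfl⟩ : ∃ k, l = k + 1 := ⟨l - 1, by omega⟩
      rw [Polynomial.coeff_sub, Polynomial.coeff_X_mul, Polynomial.coeff_sub,
        Polynomial.coeff_C_mul, Polynomial.comp_C_mul_X_coeff, hdeg (l + 1) (by omega)]
      rcases lt_or_ge i (2 * l) with h | h
      · simp [hdeg l h]
      -- The possible top coefficient carries the factor `1 - q^{2l-i}`, which is zero here.
      · obtain rfl : i = 2 * l := by omega
        rw [← pow_mul, inv_pow]
        field_simp
        ring
    · simp [hp0]
    · have h1 := hp (a * q ^ 2) (by positivity)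
      have h2 := hasSum_weight_shift (f := fun x => x ^ i) (c := (q⁻¹) ^ i * p.eval (a * q ^ 2))
        ha hq0 hq1 ((h1.mul_left ((q⁻¹) ^ i)).congr_fun fun m => by ring)
      have h3 := ((hp a ha).mul_left (1 - a)).sub h2
      have e : Polynomial.eval a (p - Polynomial.X * (p - Polynomial.C ((q⁻¹) ^ i) *
          p.comp (Polynomial.C (q ^ 2) * Polynomial.X))) =
          (1 - a) * p.eval a - -a * ((q⁻¹) ^ i * p.eval (a * q ^ 2)) := by
        simp [Polynomial.eval_comp, mul_comm (q ^ 2) a]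
        ring
      rw [e]
      exact h3.congr_fun fun m => by ring

/-! ### The basis adapted to the lattice. -/

/-- The polynomial `(q^(-m); q)_k (-a q^m; q)_k` in the variable `μ(m)`. -/
noncomputable def latticeBasis (a q : ℝ) (k : ℕ) : ℝ[X] :=
  ∏ i ∈ Finset.range k, (1 - Polynomial.C (q ^ i) * Polynomial.X - Polynomial.C (a * q ^ (2 * i)))

theorem eval_latticeBasis (a q x : ℝ) (k : ℕ) :
    (latticeBasis a q k).eval x = ∏ i ∈ Finset.range k, (1 - q ^ i * x - a * q ^ (2 * i)) := by
  simp [latticeBasis, Polynomial.eval_prod]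

theorem eval_latticeBasis_latticePoint (a : ℝ) {q : ℝ} (hq0 : 0 < q) (k m : ℕ) :
    (latticeBasis a q k).eval (latticePoint a q m) =
      qPochhammer (q ^ (-(m : ℤ))) q k * qPochhammer (-a * q ^ m) q k := by
  rw [eval_latticeBasis, qPochhammer, qPochhammer, ← Finset.prod_mul_distrib]
  refine Finset.prod_congr rfl fun i _ => ?_
  rw [latticePoint, zpow_neg, zpow_natCast]
  field_simp
  ring

/-- Splitting off the first factor exposes `1 - x - a`, as `hasSum_weight_shift` requires; the
argument `q * x` undoes its scaling by `q⁻¹`. -/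
theorem eval_latticeBasis_succ (a q x : ℝ) (k : ℕ) :
    (latticeBasis a q (k + 1)).eval x =
      (1 - x - a) * (latticeBasis (a * q ^ 2) q k).eval (q * x) := by
  rw [eval_latticeBasis, eval_latticeBasis, Finset.prod_range_succ']
  rw [mul_comm]
  congr 1
  · simp
  · refine Finset.prod_congr rfl fun i _ => ?_
    ring

theorem natDegree_latticeBasis_le (a q : ℝ) (k : ℕ) : (latticeBasis a q k).natDegree ≤ k := by
  refine (Polynomial.natDegree_prod_le _ _).trans ?_
  calc _ ≤ ∑ _i ∈ Finset.range k, 1 := Finset.sum_le_sum fun i _ => by compute_degree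
    _ = k := by simp

theorem coeff_latticeBasis_self (a q : ℝ) (k : ℕ) :
    (latticeBasis a q k).coeff k = (-1) ^ k * q ^ k.choose 2 := by
  induction k with
  | zero => simp [latticeBasis]
  | succ k ih =>
    rw [latticeBasis, Finset.prod_range_succ, ← latticeBasis,
      Polynomial.coeff_mul_add_eq_of_natDegree_le (natDegree_latticeBasis_le a q k)
        (by compute_degree), ih, Nat.choose_succ_succ' k 1, Nat.choose_one_right]
    have h : (1 - Polynomial.C (q ^ k) * Polynomial.X - Polynomial.C (a * q ^ (2 * k))).coeff 1 =
        -q ^ k := by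
      rw [Polynomial.coeff_sub, Polynomial.coeff_sub, Polynomial.coeff_C_mul, Polynomial.coeff_one,
        Polynomial.coeff_C, Polynomial.coeff_X_one]
      simp
    rw [h]
    ring

theorem hasSum_weight_latticeBasis_mul_pow {q : ℝ} (hq0 : 0 < q) (hq1 : q < 1) (i : ℕ) {F : ℝ → ℝ}
    (hF : ∀ a, 0 < a → HasSum (fun m => dualAltCharlierWeight a q m * latticePoint a q m ^ i)
      (F a)) (k : ℕ) : ∀ a, 0 < a →
    HasSum (fun m => dualAltCharlierWeight a q m *
      ((latticeBasis a q k).eval (latticePoint a q m) * latticePoint a q m ^ i))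
      ((-a) ^ k * q ^ (2 * k.choose 2) * ((q⁻¹) ^ i) ^ k * F (a * q ^ (2 * k))) := by
  induction k with
  | zero => intro a ha; simpa [latticeBasis] using hF a ha
  | succ k ih =>
    intro a ha
    have h1 := ih (a * q ^ 2) (by positivity)
    have h2 := hasSum_weight_shift
      (f := fun x => (latticeBasis (a * q ^ 2) q k).eval (q * x) * x ^ i) ha hq0 hq1
      ((h1.mul_left ((q⁻¹) ^ i)).congr_fun fun m => by
        rw [mul_inv_cancel_left₀ hq0.ne']
        ring)
    convert h2 using 1
    · funext m
      rw [eval_latticeBasis_succ]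
      ring
    · rw [show a * q ^ (2 * (k + 1)) = a * q ^ 2 * q ^ (2 * k) by ring,
        Nat.choose_succ_succ' k 1, Nat.choose_one_right, show -(a * q ^ 2) = -a * q ^ 2 by ring]
      ring

/-! ### The finite `q`-binomial theorem. -/

/-- The coefficients `(q^(-n); q)_k q^(n k) / (q; q)_k` of the finite `q`-binomial theorem. -/
noncomputable def qBinomialCoeff (q : ℝ) (n k : ℕ) : ℝ :=
  ∏ i ∈ Finset.range k, ((q ^ n - q ^ i) / (1 - q ^ (i + 1)))

theorem qBinomialCoeff_succ (q : ℝ) (n k : ℕ) :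
    qBinomialCoeff q n (k + 1) =
      qBinomialCoeff q n k * ((q ^ n - q ^ k) / (1 - q ^ (k + 1))) := by
  rw [qBinomialCoeff, Finset.prod_range_succ, qBinomialCoeff]

theorem qBinomialCoeff_eq {q : ℝ} (hq0 : 0 < q) (n k : ℕ) :
    qBinomialCoeff q n k =
      qPochhammer (q ^ (-(n : ℤ))) q k / qPochhammer q q k * (q ^ n) ^ k := by
  induction k with
  | zero => simp [qBinomialCoeff, qPochhammer]
  | succ k ih =>
    rw [qBinomialCoeff_succ, ih, qPochhammer_succ, qPochhammer_self_succ, zpow_neg, zpow_natCast,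
      pow_succ (q ^ n) k, mul_div_mul_comm]
    have h : q ^ n - q ^ k = (1 - (q ^ n)⁻¹ * q ^ k) * q ^ n := by
      field_simp
    rw [h]
    ring

theorem qBinomialCoeff_eq_zero (q : ℝ) {n k : ℕ} (h : n < k) : qBinomialCoeff q n k = 0 :=
  Finset.prod_eq_zero (Finset.mem_range.2 h) (by simp)

theorem qBinomialCoeff_succ_succ {q : ℝ} (hq0 : 0 < q) (hq1 : q < 1) (n k : ℕ) :
    qBinomialCoeff q (n + 1) (k + 1) =
      q ^ (k + 1) * qBinomialCoeff q n (k + 1) - q ^ k * qBinomialCoeff q n k := by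
  have hne : ∀ k : ℕ, 1 - q ^ (k + 1) ≠ 0 := fun k =>
    (sub_pos.2 (pow_lt_one₀ hq0.le hq1 k.succ_ne_zero)).ne'
  have h1 : qBinomialCoeff q (n + 1) (k + 1) =
      (q ^ (n + 1) - 1) * q ^ k * qBinomialCoeff q n k / (1 - q ^ (k + 1)) := by
    induction k with
    | zero => simp [qBinomialCoeff]
    | succ k ih =>
      rw [qBinomialCoeff_succ, ih, qBinomialCoeff_succ q n k]
      ring
  rw [h1, qBinomialCoeff_succ]
  have := hne k
  field_simp
  ring

theorem qBinomialCoeff_self {q : ℝ} (hq0 : 0 < q) (hq1 : q < 1) (n : ℕ) :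
    qBinomialCoeff q n n = (-1) ^ n * q ^ n.choose 2 := by
  induction n with
  | zero => simp [qBinomialCoeff]
  | succ n ih =>
    rw [qBinomialCoeff_succ_succ hq0 hq1, qBinomialCoeff_eq_zero q n.lt_succ_self, ih,
      Nat.choose_succ_succ' n 1, Nat.choose_one_right]
    ring

/-- The Pascal rule `qBinomialCoeff_succ_succ` matches `(y;q)_{n+1} = (1 - y) (qy;q)_n`. -/
theorem sum_qBinomialCoeff {q : ℝ} (hq0 : 0 < q) (hq1 : q < 1) (n : ℕ) (y : ℝ) :
    ∑ k ∈ Finset.range (n + 1), qBinomialCoeff q n k * y ^ k = qPochhammer y q n := by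
  induction n generalizing y with
  | zero => simp [qBinomialCoeff, qPochhammer]
  | succ n ih =>
    have h1 : qPochhammer y q (n + 1) = (1 - y) * qPochhammer (q * y) q n := by
      rw [qPochhammer, Finset.prod_range_succ', qPochhammer, mul_comm]
      congr 1
      · simp
      · refine Finset.prod_congr rfl fun i _ => ?_
        ring
    have h2 : ∑ k ∈ Finset.range (n + 1), qBinomialCoeff q n (k + 1) * (q * y) ^ (k + 1) + 1 =
        qPochhammer (q * y) q n := by
      have h := Finset.sum_range_succ' (fun k => qBinomialCoeff q n k * (q * y) ^ k) (n + 1)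
      rw [Finset.sum_range_succ, ih, qBinomialCoeff_eq_zero q n.lt_succ_self] at h
      simpa [qBinomialCoeff] using h.symm
    have h3 : ∑ k ∈ Finset.range (n + 1), qBinomialCoeff q (n + 1) (k + 1) * y ^ (k + 1) =
        ∑ k ∈ Finset.range (n + 1), qBinomialCoeff q n (k + 1) * (q * y) ^ (k + 1) -
          y * ∑ k ∈ Finset.range (n + 1), qBinomialCoeff q n k * (q * y) ^ k := by
      rw [Finset.mul_sum, ← Finset.sum_sub_distrib]
      refine Finset.sum_congr rfl fun k _ => ?_
      rw [qBinomialCoeff_succ_succ hq0 hq1]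
      ring
    rw [Finset.sum_range_succ', h3, ih, h1]
    simp only [qBinomialCoeff, Finset.range_zero, Finset.prod_empty, pow_zero, mul_one] at h2 ⊢
    linarith

/-! ### The polynomials and their degree. -/

/-- The dual alternative `q`-Charlier polynomial of degree `n` in the lattice variable. -/
noncomputable def dualAltCharlierPoly (a q : ℝ) (n : ℕ) : ℝ[X] :=
  ∑ k ∈ Finset.range (n + 1),
    Polynomial.C (qBinomialCoeff q n k * (-1 / a) ^ k * (q ^ (2 * k.choose 2))⁻¹) *
      latticeBasis a q k

theorem basicHypergeometricTerm_eq (a : ℝ) {q : ℝ} (hq0 : 0 < q) (n m k : ℕ) :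
    basicHypergeometricTerm [q ^ (-(m : ℤ)), -a * q ^ m, q ^ (-(n : ℤ))] [] q (-q ^ n / a) k =
      qBinomialCoeff q n k * (-1 / a) ^ k * (q ^ (2 * k.choose 2))⁻¹ *
        (latticeBasis a q k).eval (latticePoint a q m) := by
  rw [qBinomialCoeff_eq hq0, eval_latticeBasis_latticePoint a hq0]
  have h : ((-1 : ℝ) ^ k * q ^ k.choose 2) ^ (-2 : ℤ) = (q ^ (2 * k.choose 2))⁻¹ := by
    rw [zpow_neg, show (2 : ℤ) = ((2 : ℕ) : ℤ) from rfl, zpow_natCast, mul_pow, ← pow_mul,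
      mul_comm k 2, pow_mul (-1 : ℝ), neg_one_sq, one_pow, one_mul, ← pow_mul, mul_comm _ 2]
  have h2 : (-q ^ n / a) ^ k = (-1 / a) ^ k * (q ^ n) ^ k := by
    rw [← mul_pow]
    ring
  simp only [basicHypergeometricTerm, List.map_cons, List.map_nil, List.prod_cons, List.prod_nil,
    List.length_cons, List.length_nil, mul_one, one_mul]
  norm_num only [h, h2]
  ring

theorem eval_dualAltCharlierPoly (a : ℝ) {q : ℝ} (hq0 : 0 < q) (n m : ℕ) :
    (dualAltCharlierPoly a q n).eval (latticePoint a q m) = dualAltCharlier a q n m := by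
  rw [dualAltCharlier, basicHypergeometric, tsum_eq_sum (s := Finset.range (n + 1)),
    dualAltCharlierPoly, Polynomial.eval_finsetSum]
  · refine Finset.sum_congr rfl fun k _ => ?_
    rw [basicHypergeometricTerm_eq a hq0, Polynomial.eval_mul, Polynomial.eval_C]
  · intro k hk
    rw [basicHypergeometricTerm_eq a hq0, qBinomialCoeff_eq_zero q (by simpa using hk)]
    ring

theorem natDegree_dualAltCharlierPoly_le (a q : ℝ) (n : ℕ) :
    (dualAltCharlierPoly a q n).natDegree ≤ n :=
  Polynomial.natDegree_sum_le_of_forall_le _ _ fun k hk =>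
    (Polynomial.natDegree_C_mul_le _ _).trans
      ((natDegree_latticeBasis_le a q k).trans (Nat.lt_succ_iff.1 (Finset.mem_range.1 hk)))

theorem coeff_dualAltCharlierPoly_self (a : ℝ) {q : ℝ} (hq0 : 0 < q) (hq1 : q < 1) (n : ℕ) :
    (dualAltCharlierPoly a q n).coeff n = (-1 / a) ^ n := by
  rw [dualAltCharlierPoly, Polynomial.finsetSum_coeff, Finset.sum_range_succ,
    Finset.sum_eq_zero, zero_add, Polynomial.coeff_C_mul, coeff_latticeBasis_self,
    qBinomialCoeff_self hq0 hq1]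
  · have h : ((-1 : ℝ) ^ n) * (-1) ^ n = 1 := by rw [← mul_pow]; simp
    have hQ : q ^ n.choose 2 ≠ 0 := by positivity
    rw [two_mul, pow_add, mul_inv]
    linear_combination (-1 / a) ^ n * h * (q ^ n.choose 2 * (q ^ n.choose 2)⁻¹) ^ 2 +
      (-1 / a) ^ n * (q ^ n.choose 2 * (q ^ n.choose 2)⁻¹ + 1) * mul_inv_cancel₀ hQ
  · intro k hk
    rw [Polynomial.coeff_C_mul, Polynomial.coeff_eq_zero_of_natDegree_lt
      ((natDegree_latticeBasis_le a q k).trans_lt (Finset.mem_range.1 hk)), mul_zero]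

theorem degree_dualAltCharlierPoly {a q : ℝ} (ha : 0 < a) (hq0 : 0 < q) (hq1 : q < 1) (n : ℕ) :
    (dualAltCharlierPoly a q n).degree = n := by
  refine le_antisymm (Polynomial.natDegree_le_iff_degree_le.1
    (natDegree_dualAltCharlierPoly_le a q n)) (Polynomial.le_degree_of_ne_zero ?_)
  rw [coeff_dualAltCharlierPoly_self a hq0 hq1]
  exact pow_ne_zero _ (div_ne_zero (by norm_num) ha.ne')

/-! ### Orthogonality and the norm. -/

theorem qPochhammer_inv_pow_eq_zero {q : ℝ} (hq0 : 0 < q) {k n : ℕ} (h : k < n) :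
    qPochhammer ((q ^ k)⁻¹) q n = 0 :=
  Finset.prod_eq_zero (Finset.mem_range.2 h) (by
    rw [inv_mul_cancel₀ (pow_pos hq0 k).ne', sub_self])

theorem hasSum_weight_dualAltCharlierPoly_mul_pow {a q : ℝ} (ha : 0 < a) (hq0 : 0 < q)
    (hq1 : q < 1) {n i : ℕ} (hi : i ≤ n) :
    HasSum (fun m => dualAltCharlierWeight a q m *
      ((dualAltCharlierPoly a q n).eval (latticePoint a q m) * latticePoint a q m ^ i))
      (if i = n then qPochhammer ((q ^ n)⁻¹) q n else 0) := by
  obtain ⟨p, hdeg, hp0, hp⟩ := exists_moment_polynomial hq0 hq1 i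
  have hsum := hasSum_sum (s := Finset.range (n + 1)) fun k _ =>
    (hasSum_weight_latticeBasis_mul_pow hq0 hq1 i hp k a ha).mul_left
      (qBinomialCoeff q n k * (-1 / a) ^ k * (q ^ (2 * k.choose 2))⁻¹)
  have hpd : p.natDegree < i + 1 := Nat.lt_succ_iff.2
    (Polynomial.natDegree_le_iff_coeff_eq_zero.2 fun l hl => hdeg l (by omega))
  convert hsum using 1
  · rfl
  · funext m
    rw [dualAltCharlierPoly, Polynomial.eval_finsetSum, Finset.sum_mul, Finset.mul_sum]
    refine Finset.sum_congr rfl fun k _ => ?_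
    rw [Polynomial.eval_mul, Polynomial.eval_C]
    ring
  · have h1 : ∀ k, qBinomialCoeff q n k * (-1 / a) ^ k * (q ^ (2 * k.choose 2))⁻¹ *
        ((-a) ^ k * q ^ (2 * k.choose 2) * ((q⁻¹) ^ i) ^ k * p.eval (a * q ^ (2 * k))) =
        ∑ l ∈ Finset.range (i + 1), p.coeff l * a ^ l *
          (qBinomialCoeff q n k * ((q ^ i)⁻¹ * q ^ (2 * l)) ^ k) := by
      intro k
      have h2 : (-1 / a) ^ k * (-a) ^ k = 1 := by
        rw [← mul_pow, div_mul_eq_mul_div, neg_mul_neg, one_mul, div_self ha.ne', one_pow]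
      have h3 : q ^ (2 * k.choose 2) ≠ 0 := by positivity
      calc _ = ((-1 / a) ^ k * (-a) ^ k) * ((q ^ (2 * k.choose 2))⁻¹ * q ^ (2 * k.choose 2)) *
            (qBinomialCoeff q n k * ((q⁻¹) ^ i) ^ k * p.eval (a * q ^ (2 * k))) := by ring
        _ = qBinomialCoeff q n k * ((q⁻¹) ^ i) ^ k * p.eval (a * q ^ (2 * k)) := by
          rw [h2, inv_mul_cancel₀ h3, one_mul, one_mul]
        _ = _ := by
          rw [Polynomial.eval_eq_sum_range' hpd, Finset.mul_sum]
          refine Finset.sum_congr rfl fun l _ => ?_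
          rw [inv_pow]
          ring
    rw [Finset.sum_congr rfl fun k _ => h1 k, Finset.sum_comm]
    simp only [← Finset.mul_sum, sum_qBinomialCoeff hq0 hq1]
    rw [Finset.sum_range_succ', Finset.sum_eq_zero, zero_add, hp0]
    · split_ifs with h
      · simp [h]
      · simp [qPochhammer_inv_pow_eq_zero hq0 (lt_of_le_of_ne hi h)]
    · intro l _
      rcases lt_or_ge i (2 * (l + 1)) with h | h
      · simp [hdeg _ h]
      -- Here `t = i - 2(l + 1) < n`, so `(q^{-t};q)_n` contains a zero factor.
      · obtain ⟨t, rfl⟩ := Nat.exists_eq_add_of_le h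
        have e : (q ^ (2 * (l + 1) + t))⁻¹ * q ^ (2 * (l + 1)) = (q ^ t)⁻¹ := by
          rw [pow_add]
          field_simp
        rw [e, qPochhammer_inv_pow_eq_zero hq0 (by omega), mul_zero]

theorem mul_self_eq_choose_two_add (n : ℕ) : n * n = n.choose 2 + (n + 1).choose 2 := by
  induction n with
  | zero => rfl
  | succ n ih =>
    rw [Nat.choose_succ_succ' (n + 1) 1, Nat.choose_one_right]
    have h := Nat.choose_succ_succ' n 1
    rw [Nat.choose_one_right] at h
    linarith

/-- Expanding the factor of lower degree in powers of `μ` leaves only its leading term, and that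
only when `n' = n`. -/
theorem hasSum_weight_dualAltCharlier_mul_of_le {a q : ℝ} (ha : 0 < a) (hq0 : 0 < q)
    (hq1 : q < 1) {n n' : ℕ} (h : n' ≤ n) :
    HasSum (fun m => dualAltCharlierWeight a q m * dualAltCharlier a q n m *
      dualAltCharlier a q n' m)
      (if n = n' then qPochhammer q q n / (a ^ n * q ^ (n * (n + 1) / 2)) else 0) := by
  have hsum := hasSum_sum (s := Finset.range (n' + 1)) fun i hi =>
    (hasSum_weight_dualAltCharlierPoly_mul_pow ha hq0 hq1
      ((Nat.lt_succ_iff.1 (Finset.mem_range.1 hi)).trans h)).mul_left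
        ((dualAltCharlierPoly a q n').coeff i)
  convert hsum using 1
  · rfl
  · funext m
    rw [← eval_dualAltCharlierPoly a hq0 n, ← eval_dualAltCharlierPoly a hq0 n',
      Polynomial.eval_eq_sum_range' (p := dualAltCharlierPoly a q n')
        (Nat.lt_succ_iff.2 (natDegree_dualAltCharlierPoly_le a q n')), Finset.mul_sum]
    refine Finset.sum_congr rfl fun i _ => ?_
    ring
  · rw [Finset.sum_range_succ, Finset.sum_eq_zero, zero_add]
    · split_ifs with h1 h2 h2
      · subst h1
        -- Two evaluations of the top `q`-binomial coefficient express `(q^{-n};q)_n` through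
        -- `(q;q)_n`.
        have hB := qBinomialCoeff_eq hq0 n n
        rw [qBinomialCoeff_self hq0 hq1, zpow_neg, zpow_natCast] at hB
        have hD := (qPochhammer_self_pos hq0 hq1 n).ne'
        have e : n * n = n.choose 2 + n * (n + 1) / 2 := by
          have h3 : n * (n + 1) / 2 = (n + 1).choose 2 := by
            rw [Nat.choose_two_right, Nat.add_sub_cancel, mul_comm]
          rw [h3, mul_self_eq_choose_two_add]
        rw [← pow_mul, e, pow_add] at hB
        rw [coeff_dualAltCharlierPoly_self a hq0 hq1, div_pow]
        have hs : ((-1 : ℝ) ^ n) * (-1) ^ n = 1 := by rw [← mul_pow]; simp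
        have hQ : q ^ n.choose 2 ≠ 0 := by positivity
        have hR : q ^ (n * (n + 1) / 2) ≠ 0 := by positivity
        generalize (-1 : ℝ) ^ n = s at *
        generalize qPochhammer ((q ^ n)⁻¹) q n = Y at *
        generalize qPochhammer q q n = D at *
        generalize q ^ (n * (n + 1) / 2) = R at *
        have hB' : s * D = Y * R := by
          field_simp at hB
          linarith
        field_simp
        linear_combination (-D) * hs + s * hB'
      · exact absurd h1.symm h2
      · exact absurd h2.symm h1
      · ring
    · intro i hi
      rw [if_neg (by have := Finset.mem_range.1 hi; omega), mul_zero]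

theorem mainTheorem1 (a q : ℝ) (ha : 0 < a) (hq0 : 0 < q) (hq1 : q < 1) :
    (∀ n : ℕ, ∃ P : ℝ[X], P.degree = (n : WithBot ℕ) ∧
      ∀ m : ℕ, P.eval (latticePoint a q m) = dualAltCharlier a q n m) ∧
    (∀ n n' : ℕ,
      HasSum
        (fun m : ℕ =>
          dualAltCharlierWeight a q m * dualAltCharlier a q n m * dualAltCharlier a q n' m)
        (if n = n' then qPochhammer q q n / (a ^ n * q ^ (n * (n + 1) / 2)) else 0)) := by
  refine ⟨fun n => ⟨dualAltCharlierPoly a q n, degree_dualAltCharlierPoly ha hq0 hq1 n,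
    eval_dualAltCharlierPoly a hq0 n⟩, fun n n' => ?_⟩
  rcases le_total n' n with h | h
  · exact hasSum_weight_dualAltCharlier_mul_of_le ha hq0 hq1 h
  · convert hasSum_weight_dualAltCharlier_mul_of_le ha hq0 hq1 h using 1
    · funext m
      ring
    · by_cases e : n = n'
      · subst e; rfl
      · rw [if_neg e, if_neg (Ne.symm e)]
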